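/- Let $A,D\in\mathbb C^{n\times n}$ and let $\lambda_0$ be an eigenvalue of $A$ whose largest Jordan block has size $k\ge 1$; for $1\le j\le k$ let $s_j\ge 0$ be the number of Jordan blocks of size $j$ of $A$ for $\lambda_0$ (so $s_k>0$). Let $[\Xi\ \ \Xi_c]\in\mathbb C^{n\times n}$ be invertible, $[\Sigma\ \ \Sigma_c]=[\Xi\ \ \Xi_c]^{-*}$, with $$A[\Xi\ \ \Xi_c]=[\Xi\ \ \Xi_c]\begin{bmatrix}\lambda_0I+N&0\\0&A_{22}\end{bmatrix},\qquad N=\operatorname{diag}(N_1,\dots,N_k),\qquad \lambda_0\notin\Lambda(A_{22}),$$ where $N_j$ is the $j\times j$ block matrix with blocks of size $s_j\times s_j$, equal to $I_{s_j}$ on the first block superdiagonal and $0$ elsewhere. Partition conformally $\Xi=[\Xi_1\ \cdots\ \Xi_k]$, $\Xi_j=[\Xi_{j1}\ \cdots\ \Xi_{jj}]$, $\Sigma=[\Sigma_1\ \cdots\ \Sigma_k]$, $\Sigma_j=[\Sigma_{j1}\ \cdots\ \Sigma_{jj}]$, where each $\Xi_{jm},\Sigma_{jm}$ has $s_j$ columns.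 Put $$W_i=[\Sigma_{ii}\ \Sigma_{i+1,i+1}\ \cdots\ \Sigma_{kk}]^*\,D\,[\Xi_{i1}\ \Xi_{i+1,1}\ \cdots\ \Xi_{k1}],\qquad i=1,\dots,k,$$ and assume that $W_1,\dots,W_k$ are all invertible. Let $$\Theta_k=\begin{bmatrix}0&I_{s_k}&&\\&0&\ddots&\\&&\ddots&I_{s_k}\\W_k&&&0\end{bmatrix}\in\mathbb C^{ks_k\times ks_k}\qquad(\Theta_1=W_1\text{ if }k=1).$$ Let $\widetilde\Phi\in\mathbb C^{ks_k\times r}$ have rank $r$ and satisfy $\Theta_k\widetilde\Phi=\widetilde\Phi\,\Omega$ with $\Omega\in\mathbb C^{r\times r}$, and assume that the eigenvalues of $\Omega$ are different from the remaining eigenvalues of $\Theta_k$ (the multiset of eigenvalues of $\Theta_k$ minus the multiset of eigenvalues of $\Omega$, both counted with algebraic multiplicity, contains no eigenvalue of $\Omega$). Let $Q_1\in\mathbb C^{s_k\times r}$ be the first block row of $\widetilde\Phi$, so that $\widetilde\Phi=[Q_1^T\ (Q_1\Omega)^T\ \cdots\ (Q_1\Omega^{k-1})^T]^T$. Then there are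 matrices $C=C(t)\in\mathbb C^{r\times r}$ and $H=H(t)\in\mathbb C^{n\times r}$ such that, for all sufficiently small $t>0$, $$(A+tD)H=HC,\qquad C=\lambda_0I+t^{1/k}\Omega+O(t^{2/k}),\qquad H=\Xi_{k1}Q_1+\sum_{i=1}^k\Xi_iH_i+O(t),$$ where, with $H_i=H_i(t)$ partitioned into $i$ block rows of height $s_i$, $$H_i=O\left(\begin{bmatrix}t^{1-i/k}&t^{1-(i-1)/k}&\cdots&t^{1-1/k}\end{bmatrix}^T\right),\qquad 1\le i\le k-1,$$ $$H_k=\begin{bmatrix}0&(Q_1(t^{1/k}\Omega))^T&\cdots&(Q_1(t^{1/k}\Omega)^{k-1})^T\end{bmatrix}^T+O\left(\begin{bmatrix}t^{1/k}&t^{2/k}&\cdots&t\end{bmatrix}^T\right).$$ Here $O(t^c)$ is a matrix bounded in norm by a constant times $t^c$ as $t\to0^+$, and $O$ of a column of powers gives the order of each block row. -/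

import Mathlib

open Filter Topology Asymptotics

noncomputable section

namespace JordanPert

/-- Indices of the part of the Jordan form that belongs to the single eigenvalue `lam0`, with
`s j` Jordan blocks of size `j` for `1 ≤ j ≤ k`. The index `⟨j, m, p⟩` is position `p` inside
the `(m+1)`-st block (each of width `s j`) of the `j`-th diagonal block. -/
abbrev JIdx (k : ℕ) (s : ℕ → ℕ) : Type :=
  Σ j : Finset.Icc 1 k, Fin (j : ℕ) × Fin (s j)

/-- The index of the largest Jordan block size `k`. -/
abbrev top {k : ℕ} (hk : 1 ≤ k) : Finset.Icc 1 k := ⟨k, Finset.mem_Icc.mpr ⟨hk, le_rfl⟩⟩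

/-- The first block position inside the `j`-th diagonal block. -/
def firstPos {k : ℕ} (j : Finset.Icc 1 k) : Fin (j : ℕ) :=
  ⟨0, (Finset.mem_Icc.mp j.2).1⟩

/-- The last block position inside the `j`-th diagonal block. -/
def lastPos {k : ℕ} (j : Finset.Icc 1 k) : Fin (j : ℕ) :=
  ⟨(j : ℕ) - 1, Nat.sub_lt (Finset.mem_Icc.mp j.2).1 Nat.one_pos⟩

/-- `N = diag(N_1, …, N_k)`, where `N_j` is `j × j` block matrix with the identity of size `s j`
on the block superdiagonal and zeros elsewhere. -/
def nilpotentPart (k : ℕ) (s : ℕ → ℕ) : Matrix (JIdx k s) (JIdx k s) ℂ :=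
  Matrix.of fun x y =>
    if x.1 = y.1 ∧ (x.2.1 : ℕ) + 1 = (y.2.1 : ℕ) ∧ (x.2.2 : ℕ) = (y.2.2 : ℕ) then 1 else 0

/-- The block column `M_j` of `M = [M_1 … M_k]`. -/
def blockCol {n k : ℕ} {s : ℕ → ℕ} (M : Matrix (Fin n) (JIdx k s) ℂ) (j : Finset.Icc 1 k) :
    Matrix (Fin n) (Fin (j : ℕ) × Fin (s j)) ℂ :=
  M.submatrix id fun y => ⟨j, y⟩

/-- The sub-block column `M_{j,m+1}` of `M_j = [M_{j1} … M_{jj}]`. -/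
def subCol {n k : ℕ} {s : ℕ → ℕ} (M : Matrix (Fin n) (JIdx k s) ℂ) (j : Finset.Icc 1 k)
    (m : Fin (j : ℕ)) : Matrix (Fin n) (Fin (s j)) ℂ :=
  M.submatrix id fun p => ⟨j, (m, p)⟩

/-- Column indices of `[M_{i,·} M_{i+1,·} … M_{k,·}]`, one sub-block column for each size `≥ i`. -/
abbrev EIdx (k : ℕ) (s : ℕ → ℕ) (i : Finset.Icc 1 k) : Type :=
  Σ j : {j : Finset.Icc 1 k // i ≤ j}, Fin (s j.1)

/-- `[Xi_{i1} Xi_{i+1,1} … Xi_{k1}]`: right eigenvectors of the Jordan blocks of size `≥ i`. -/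
def tildeXi {n k : ℕ} {s : ℕ → ℕ} (Xi : Matrix (Fin n) (JIdx k s) ℂ) (i : Finset.Icc 1 k) :
    Matrix (Fin n) (EIdx k s i) ℂ :=
  Matrix.of fun a x => subCol Xi x.1.1 (firstPos x.1.1) a x.2

/-- `[Sg_{ii} Sg_{i+1,i+1} … Sg_{kk}]`: left eigenvectors of the Jordan blocks of size `≥ i`. -/
def tildeSg {n k : ℕ} {s : ℕ → ℕ} (Sg : Matrix (Fin n) (JIdx k s) ℂ) (i : Finset.Icc 1 k) :
    Matrix (Fin n) (EIdx k s i) ℂ :=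
  Matrix.of fun a x => subCol Sg x.1.1 (lastPos x.1.1) a x.2

open Matrix in
/-- `W_i`, the compression of `D` to the eigenvectors of the Jordan blocks of size `≥ i`. -/
def W {n k : ℕ} {s : ℕ → ℕ} (D : Matrix (Fin n) (Fin n) ℂ) (Xi Sg : Matrix (Fin n) (JIdx k s) ℂ)
    (i : Finset.Icc 1 k) : Matrix (EIdx k s i) (EIdx k s i) ℂ :=
  (tildeSg Sg i)ᴴ * D * tildeXi Xi i

open Matrix in
/-- `S_k = Sg_{kk}^* D Xi_{k1}`, which is `W_k` written with index type `Fin (s k)`. -/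
def topS {n k : ℕ} {s : ℕ → ℕ} (hk : 1 ≤ k) (D : Matrix (Fin n) (Fin n) ℂ)
    (Xi Sg : Matrix (Fin n) (JIdx k s) ℂ) : Matrix (Fin (s k)) (Fin (s k)) ℂ :=
  (subCol Sg (top hk) (lastPos (top hk)))ᴴ * D * subCol Xi (top hk) (firstPos (top hk))

/-- The `k × k` block companion matrix with identities on the block superdiagonal and `S` in the
lower left corner (equal to `S` when `k = 1`). -/
def blockCompanion (k q : ℕ) (S : Matrix (Fin q) (Fin q) ℂ) :
    Matrix (Fin k × Fin q) (Fin k × Fin q) ℂ :=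
  Matrix.of fun x y =>
    (if (x.1 : ℕ) + 1 = (y.1 : ℕ) ∧ x.2 = y.2 then 1 else 0) +
      (if (x.1 : ℕ) + 1 = k ∧ (y.1 : ℕ) = 0 then S x.2 y.2 else 0)

/-- The first block row of a matrix with `k ≥ 1` block rows of height `q`. -/
def topRow {k q r : ℕ} (hk : 1 ≤ k) (Phi : Matrix (Fin k × Fin q) (Fin r) ℂ) :
    Matrix (Fin q) (Fin r) ℂ :=
  Phi.submatrix (fun p => (⟨0, hk⟩, p)) id

/-- `F(t) = O(t ^ c)` as `t → 0+`, entrywise (equivalently, in any matrix norm). -/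
def MatBigO {ι κ : Type*} (F : ℝ → Matrix ι κ ℂ) (c : ℝ) : Prop :=
  ∀ a b, (fun t : ℝ => F t a b) =O[𝓝[>] (0 : ℝ)] fun t : ℝ => t ^ c

/-- The block row `M_{m+1}` of a matrix partitioned into `i` block rows of height `q`. -/
def blockRow {i q r : ℕ} (M : Matrix (Fin i × Fin q) (Fin r) ℂ) (m : Fin i) :
    Matrix (Fin q) (Fin r) ℂ :=
  M.submatrix (fun p => (m, p)) id

end JordanPert

end

/-
Put `e = t ^ (1 / k)`. In the basis `[Xi Xic]`, multiplying the `m`-th block row (counted from `0`)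
of the Jordan blocks of size `j` by `e ^ (k - j + m)` and the complementary rows by `e ^ k` turns
the equation for an invariant subspace basis `U` with eigenvalue matrix `lam0 + e Ω` into a pencil
equation `G(e) U = P(e) U Ω` with coefficients polynomial in `e`. At `e = 0` the blocks of size `k`
decouple and give `blockCompanion Φ = Φ Ω`; since `Ω` is invertible, all other rows are then
uniquely determined by the first block row of `Φ`. Because the spectrum of `Ω` is separated from
the rest of the spectrum of the block companion matrix, the linearization at `e = 0`, with a
normalization of `U`, is injective, so the implicit function theorem continues `(U, Ω)`
differentiably in `e`. Undoing the scaling gives the stated powers of `t`.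
-/

noncomputable section

namespace JordanPert

open Matrix

section SimpleDeflatingPair

theorem linearIndependent_col_of_rank_eq_card {R ι κ : Type*} [Field R] [Fintype κ]
    {Φ : Matrix ι κ R} (hΦ : Φ.rank = Fintype.card κ) : LinearIndependent R Φ.col := by
  rw [linearIndependent_iff_card_eq_finrank_span, Set.finrank, ← rank_eq_finrank_span_cols, hΦ]

theorem blocks_of_fromRows_mul_fromCols_eq_one {R ι κ m : Type*} [CommRing R]
    [Fintype ι] [DecidableEq κ] [DecidableEq m] {Φ : Matrix ι κ R} {Ψ : Matrix ι m R}
    {L : Matrix κ ι R} {M : Matrix m ι R} (h : fromRows L M * fromCols Φ Ψ = 1) :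
    L * Φ = 1 ∧ M * Φ = 0 := by
  rw [fromRows_mul_fromCols, ← fromBlocks_one, fromBlocks_inj] at h
  exact ⟨h.1, h.2.2.1⟩

variable {R ι κ : Type*} [Fintype ι] [DecidableEq ι] [Fintype κ] [DecidableEq κ]

theorem pow_mul_eq_mul_pow [Semiring R] {A : Matrix ι ι R} {B : Matrix κ κ R}
    {X : Matrix ι κ R} (h : A * X = X * B) (m : ℕ) : A ^ m * X = X * B ^ m := by
  induction m with
  | zero => simp
  | succ m ih =>
    rw [pow_succ, pow_succ, Matrix.mul_assoc, h, ← Matrix.mul_assoc, ih, Matrix.mul_assoc]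

theorem aeval_mul_eq_mul_aeval [CommRing R] {A : Matrix ι ι R} {B : Matrix κ κ R}
    {X : Matrix ι κ R} (h : A * X = X * B) (p : Polynomial R) :
    Polynomial.aeval A p * X = X * Polynomial.aeval B p := by
  induction p using Polynomial.induction_on' with
  | add p q hp hq => simp only [map_add, Matrix.add_mul, Matrix.mul_add, hp, hq]
  | monomial m a =>
    rw [Polynomial.aeval_monomial, Polynomial.aeval_monomial, ← Algebra.smul_def,
      ← Algebra.smul_def, Matrix.smul_mul, Matrix.mul_smul, pow_mul_eq_mul_pow h]

theorem eq_zero_of_isCoprime_charpoly [CommRing R] {A : Matrix ι ι R} {B : Matrix κ κ R}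
    {X : Matrix ι κ R} (hAB : IsCoprime A.charpoly B.charpoly) (h : A * X = X * B) : X = 0 := by
  obtain ⟨u, v, huv⟩ := hAB
  calc X = Polynomial.aeval A (u * A.charpoly + v * B.charpoly) * X := by simp [huv]
    _ = Polynomial.aeval A (v * B.charpoly) * X := by simp [aeval_self_charpoly]
    _ = X * Polynomial.aeval B (v * B.charpoly) := aeval_mul_eq_mul_aeval h _
    _ = 0 := by simp [aeval_self_charpoly]

theorem isCoprime_charpoly_of_disjoint_roots [Field R] [IsAlgClosed R] {A : Matrix ι ι R}
    {B : Matrix κ κ R} (hAB : ∀ μ ∈ B.charpoly.roots, μ ∉ A.charpoly.roots) :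
    IsCoprime A.charpoly B.charpoly := by
  refine (Polynomial.isCoprime_iff_aeval_ne_zero_of_isAlgClosed R R _ _).2 fun μ => ?_
  by_contra! hμ
  refine hAB μ ?_ ?_
  · simpa [Polynomial.mem_roots (charpoly_monic B).ne_zero] using hμ.2
  · simpa [Polynomial.mem_roots (charpoly_monic A).ne_zero] using hμ.1

theorem isUnit_of_invariant [Field R] {T : Matrix ι ι R} {Φ : Matrix ι κ R} {Ω : Matrix κ κ R}
    (hT : IsUnit T) (hrank : Φ.rank = Fintype.card κ) (hΦ : T * Φ = Φ * Ω) : IsUnit Ω := by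
  refine mulVec_injective_iff_isUnit.1 (Function.Injective.of_comp (f := Φ.mulVec) ?_)
  have hcomp : Φ.mulVec ∘ Ω.mulVec = T.mulVec ∘ Φ.mulVec := by
    ext1 v
    simp only [Function.comp_apply, mulVec_mulVec, hΦ]
  rw [hcomp]
  exact (mulVec_injective_iff_isUnit.2 hT).comp
    (mulVec_injective_iff.2 (linearIndependent_col_of_rank_eq_card hrank))

theorem exists_fromCols_inverse [Field R] {Φ : Matrix ι κ R} (hΦ : Φ.rank = Fintype.card κ) :
    ∃ (m : Set (ι → R)) (_ : Fintype m) (_ : DecidableEq m) (Ψ : Matrix ι m R)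
      (L : Matrix κ ι R) (M : Matrix m ι R),
      fromCols Φ Ψ * fromRows L M = 1 ∧ fromRows L M * fromCols Φ Ψ = 1 := by
  classical
  have hli := linearIndependent_col_of_rank_eq_card hΦ
  let m := Module.Basis.sumExtendIndex hli
  let b : Module.Basis (κ ⊕ m) R (ι → R) := Module.Basis.sumExtend hli
  have : Finite (κ ⊕ m) := Module.Finite.finite_basis b
  have : Finite m := Finite.of_injective _ (Sum.inr_injective (α := κ))
  have hb : ∀ j, b (Sum.inl j) = Φ.col j := fun j => by
    simp only [b, Module.Basis.sumExtend, Module.Basis.reindex_apply,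
      Module.Basis.extend_apply_self]
    rfl
  let P := (Pi.basisFun R ι).toMatrix b
  let P' := b.toMatrix (Pi.basisFun R ι)
  have hP : fromCols Φ P.toCols₂ = P := by
    conv_rhs => rw [← fromCols_toCols P]
    congr 1
    ext i j
    simp [P, Module.Basis.toMatrix_apply, hb]
  have : Fintype m := Fintype.ofFinite m
  refine ⟨m, this, inferInstance, P.toCols₂, P'.toRows₁, P'.toRows₂, ?_, ?_⟩
  all_goals
    rw [hP, fromRows_toRows]
    exact Module.Basis.toMatrix_mul_toMatrix_flip _ _

section Completion

variable {m : Type*} [Fintype m] [DecidableEq m] {T : Matrix ι ι R} {Φ : Matrix ι κ R}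
  {Ψ : Matrix ι m R} {L : Matrix κ ι R} {M : Matrix m ι R} {Ω : Matrix κ κ R}

theorem charpoly_mul_mul_of_inverse [CommRing R] [Nontrivial R] {P : Matrix ι m R}
    {P' : Matrix m ι R} (h : P * P' = 1) (h' : P' * P = 1) (T : Matrix ι ι R) :
    (P' * T * P).charpoly = T.charpoly := by
  have hcard : Fintype.card ι = Fintype.card m := square_of_invertible P P' h h'
  rw [Matrix.mul_assoc, charpoly_mul_comm_of_le _ _ hcard.le, hcard, tsub_self, pow_zero, one_mul,
    Matrix.mul_assoc, h, Matrix.mul_one]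

variable [CommRing R]

theorem charpoly_eq_mul_of_invariant [Nontrivial R] (h : fromCols Φ Ψ * fromRows L M = 1)
    (h' : fromRows L M * fromCols Φ Ψ = 1) (hΦ : T * Φ = Φ * Ω) :
    T.charpoly = Ω.charpoly * (M * T * Ψ).charpoly := by
  obtain ⟨hL, hM⟩ := blocks_of_fromRows_mul_fromCols_eq_one h'
  have hblocks : fromRows L M * T * fromCols Φ Ψ = fromBlocks Ω (L * T * Ψ) 0 (M * T * Ψ) := by
    rw [fromRows_mul, fromRows_mul_fromCols, Matrix.mul_assoc L T Φ, Matrix.mul_assoc M T Φ, hΦ,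
      ← Matrix.mul_assoc, ← Matrix.mul_assoc, hL, hM, Matrix.one_mul, Matrix.zero_mul]
  rw [← charpoly_mul_mul_of_inverse h h' T, hblocks, charpoly_fromBlocks_zero₂₁]

theorem mul_eq_mul_of_invariant (h : fromCols Φ Ψ * fromRows L M = 1)
    (h' : fromRows L M * fromCols Φ Ψ = 1) (hΦ : T * Φ = Φ * Ω) :
    M * T = M * T * Ψ * M := by
  have hM : M * Φ = 0 := (blocks_of_fromRows_mul_fromCols_eq_one h').2
  calc M * T = M * T * (Φ * L + Ψ * M) := by rw [← fromCols_mul_fromRows, h, Matrix.mul_one]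
    _ = M * Φ * (Ω * L) + M * T * Ψ * M := by
      simp only [Matrix.mul_add, Matrix.mul_assoc, ← Matrix.mul_assoc T Φ L, hΦ]
    _ = M * T * Ψ * M := by rw [hM, Matrix.zero_mul, zero_add]

end Completion

/-- A solution `(U, Ω)` of the pencil equation `G U = P U Ω`, normalized by `N U = 1`, which is
simple: the linearization of this equation together with the normalization has trivial kernel. -/
structure IsSimpleDeflatingPair [CommRing R] (G P : Matrix ι ι R) (N : Matrix κ ι R)
    (U : Matrix ι κ R) (Ω : Matrix κ κ R) : Prop where
  mul_eq : G * U = P * U * Ω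
  normalized : N * U = 1
  injective : ∀ (V : Matrix ι κ R) (B : Matrix κ κ R),
    G * V = P * V * Ω + P * U * B → N * V = 0 → V = 0 ∧ B = 0

theorem exists_isSimpleDeflatingPair [Field R] [IsAlgClosed R] [DecidableEq R]
    {T : Matrix ι ι R} {Φ : Matrix ι κ R} {Ω : Matrix κ κ R} (hrank : Φ.rank = Fintype.card κ)
    (hΦ : T * Φ = Φ * Ω)
    (hroots : ∀ μ ∈ Ω.charpoly.roots, μ ∉ T.charpoly.roots - Ω.charpoly.roots) :
    ∃ L : Matrix κ ι R, IsSimpleDeflatingPair T 1 L Φ Ω := by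
  obtain ⟨m, _, _, Ψ, L, M, h, h'⟩ := exists_fromCols_inverse hrank
  obtain ⟨hL, hM⟩ := blocks_of_fromRows_mul_fromCols_eq_one h'
  have hcoprime : IsCoprime (M * T * Ψ).charpoly Ω.charpoly := by
    refine isCoprime_charpoly_of_disjoint_roots ?_
    rwa [charpoly_eq_mul_of_invariant h h' hΦ, Polynomial.roots_mul
      ((charpoly_monic _).mul (charpoly_monic _)).ne_zero, add_tsub_cancel_left] at hroots
  refine ⟨L, by rw [hΦ, Matrix.one_mul], hL, fun V B hV hLV => ?_⟩
  rw [Matrix.one_mul, Matrix.one_mul] at hV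
  have hMV : M * V = 0 := by
    refine eq_zero_of_isCoprime_charpoly hcoprime ?_
    calc M * T * Ψ * (M * V) = M * (T * V) := by
          rw [← Matrix.mul_assoc, ← mul_eq_mul_of_invariant h h' hΦ, Matrix.mul_assoc]
      _ = M * V * Ω + M * Φ * B := by rw [hV, Matrix.mul_add, Matrix.mul_assoc, Matrix.mul_assoc]
      _ = M * V * Ω := by rw [hM, Matrix.zero_mul, add_zero]
  have hV0 : V = 0 := by
    calc V = fromCols Φ Ψ * (fromRows L M * V) := by rw [← Matrix.mul_assoc, h, Matrix.one_mul]
      _ = 0 := by rw [fromRows_mul, hLV, hMV, fromRows_zero, Matrix.mul_zero]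
  refine ⟨hV0, ?_⟩
  calc B = L * (Φ * B) := by rw [← Matrix.mul_assoc, hL, Matrix.one_mul]
    _ = 0 := by
      rw [hV0, Matrix.mul_zero, Matrix.zero_mul, zero_add] at hV
      rw [← hV, Matrix.mul_zero]

end SimpleDeflatingPair

section Perturbation

variable {𝕜 : Type*} [RCLike 𝕜]

theorem isInvertible_of_injective {E : Type*} [NormedAddCommGroup E] [NormedSpace 𝕜 E]
    [FiniteDimensional 𝕜 E] {f : E →L[𝕜] E} (hf : ∀ v, f v = 0 → v = 0) : f.IsInvertible := by
  have hinj : Function.Injective (f : E →ₗ[𝕜] E) := (injective_iff_map_eq_zero _).2 hf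
  exact ⟨(LinearEquiv.ofInjectiveEndo (f : E →ₗ[𝕜] E) hinj).toContinuousLinearEquiv, by ext; rfl⟩

theorem exists_implicit_solution {E : Type*} [NormedAddCommGroup E] [NormedSpace 𝕜 E]
    [FiniteDimensional 𝕜 E] {F : 𝕜 × E → E} {x₀ : E} (hF : ContDiffAt 𝕜 1 F (0, x₀))
    (h₀ : F (0, x₀) = 0)
    (hinj : ∀ v, HasLineDerivAt 𝕜 (fun x => F (0, x)) 0 x₀ v → v = 0) :
    ∃ x : 𝕜 → E, x 0 = x₀ ∧ DifferentiableAt 𝕜 x 0 ∧ ∀ᶠ e in 𝓝 0, F (e, x e) = 0 := by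
  have : CompleteSpace E := FiniteDimensional.complete 𝕜 E
  have hstrict : HasStrictFDerivAt F (fderiv 𝕜 F (0, x₀)) (0, x₀) :=
    hF.hasStrictFDerivAt one_ne_zero
  have hpartial : HasFDerivAt (fun x => F (0, x))
      ((fderiv 𝕜 F (0, x₀)).comp (ContinuousLinearMap.inr 𝕜 𝕜 E)) x₀ :=
    hstrict.hasFDerivAt.comp x₀ (hasFDerivAt_prodMk_right 0 x₀)
  have hinv : ((fderiv 𝕜 F (0, x₀)).comp (ContinuousLinearMap.inr 𝕜 𝕜 E)).IsInvertible :=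
    isInvertible_of_injective fun v hv => hinj v (hv ▸ hpartial.hasLineDerivAt v)
  refine ⟨hstrict.implicitFunctionOfProdDomain hinv, ?_,
    (hstrict.hasStrictFDerivAt_implicitFunctionOfProdDomain hinv).hasFDerivAt.differentiableAt, ?_⟩
  · exact (hstrict.eventually_apply_eq_iff_implicitFunctionOfProdDomain hinv).self_of_nhds.1 rfl
  · simpa only [h₀] using hstrict.eventually_apply_implicitFunctionOfProdDomain hinv

theorem hasDerivAt_smul_add_sq_smul {E : Type*} [NormedAddCommGroup E] [NormedSpace 𝕜 E]
    (a b : E) : HasDerivAt (fun s : 𝕜 => s • a + s ^ 2 • b) a 0 := by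
  simpa using ((hasDerivAt_id (0 : 𝕜)).smul_const a).fun_add
    ((hasDerivAt_pow 2 (0 : 𝕜)).smul_const b)

variable {ι κ : Type*} [Fintype ι] [Fintype κ] [DecidableEq κ]

open scoped Matrix.Norms.Elementwise

theorem contDiffAt_matrix {m n E : Type*} [Fintype m] [Fintype n] [NormedAddCommGroup E]
    [NormedSpace 𝕜 E] {x : E} {A : E → Matrix m n 𝕜} :
    ContDiffAt 𝕜 1 A x ↔ ∀ i j, ContDiffAt 𝕜 1 (fun e => A e i j) x :=
  contDiffAt_pi.trans <| forall_congr' fun _ => contDiffAt_pi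

theorem contDiffAt_matrix_mul {l m n E : Type*} [Fintype l] [Fintype m] [Fintype n]
    [NormedAddCommGroup E] [NormedSpace 𝕜 E] {x : E} {A : E → Matrix l m 𝕜} {B : E → Matrix m n 𝕜}
    (hA : ContDiffAt 𝕜 1 A x) (hB : ContDiffAt 𝕜 1 B x) :
    ContDiffAt 𝕜 1 (fun e => A e * B e) x := by
  refine contDiffAt_matrix.2 fun i j => ?_
  simp only [Matrix.mul_apply]
  exact ContDiffAt.sum fun a _ =>
    (contDiffAt_matrix.1 hA i a).mul (contDiffAt_matrix.1 hB a j)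

/-- The map whose zeros `(U, Ω)` are the solutions of `G U = P U Ω` normalized by `N U = 1`. -/
def pairResidual (G P : Matrix ι ι 𝕜) (N : Matrix κ ι 𝕜) (x : Matrix ι κ 𝕜 × Matrix κ κ 𝕜) :
    Matrix ι κ 𝕜 × Matrix κ κ 𝕜 :=
  (G * x.1 - P * x.1 * x.2, N * x.1 - 1)

theorem IsSimpleDeflatingPair.pairResidual_add_smul {G P : Matrix ι ι 𝕜} {N : Matrix κ ι 𝕜}
    {U : Matrix ι κ 𝕜} {Ω : Matrix κ κ 𝕜} (h : IsSimpleDeflatingPair G P N U Ω)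
    (x : Matrix ι κ 𝕜 × Matrix κ κ 𝕜) (c : 𝕜) :
    pairResidual G P N ((U, Ω) + c • x) =
      c • (G * x.1 - (P * x.1 * Ω + P * U * x.2), N * x.1) + c ^ 2 • (-(P * x.1 * x.2), 0) := by
  ext1
  · simp only [pairResidual, Prod.fst_add, Prod.snd_add, Prod.smul_fst, Prod.smul_snd,
      Matrix.mul_add, Matrix.add_mul, Matrix.mul_smul, Matrix.smul_mul, h.mul_eq]
    module
  · simp [pairResidual, Matrix.mul_add, h.normalized]

theorem IsSimpleDeflatingPair.eq_zero_of_hasLineDerivAt {G P : Matrix ι ι 𝕜} {N : Matrix κ ι 𝕜}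
    {U : Matrix ι κ 𝕜} {Ω : Matrix κ κ 𝕜} (h : IsSimpleDeflatingPair G P N U Ω)
    (x : Matrix ι κ 𝕜 × Matrix κ κ 𝕜) (hx : HasLineDerivAt 𝕜 (pairResidual G P N) 0 (U, Ω) x) :
    x = 0 := by
  have hlinear := (hasDerivAt_smul_add_sq_smul _ _).unique
    (hx.congr_deriv rfl |>.congr_of_eventuallyEq <|
      .of_forall fun c => (h.pairResidual_add_smul x c).symm)
  obtain ⟨h₁, h₂⟩ := Prod.mk_eq_zero.1 hlinear
  obtain ⟨hV, hB⟩ := h.injective x.1 x.2 (sub_eq_zero.1 h₁) h₂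
  exact Prod.ext hV hB

theorem exists_deflatingPair_perturbation {G P : 𝕜 → Matrix ι ι 𝕜} {N : Matrix κ ι 𝕜}
    {U₀ : Matrix ι κ 𝕜} {Ω₀ : Matrix κ κ 𝕜} (hG : ContDiffAt 𝕜 1 G 0) (hP : ContDiffAt 𝕜 1 P 0)
    (h : IsSimpleDeflatingPair (G 0) (P 0) N U₀ Ω₀) :
    ∃ (U : 𝕜 → Matrix ι κ 𝕜) (Ω : 𝕜 → Matrix κ κ 𝕜), U 0 = U₀ ∧ Ω 0 = Ω₀ ∧
      DifferentiableAt 𝕜 U 0 ∧ DifferentiableAt 𝕜 Ω 0 ∧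
      ∀ᶠ e in 𝓝 0, G e * U e = P e * U e * Ω e := by
  have hF : ContDiffAt 𝕜 1 (fun y : 𝕜 × Matrix ι κ 𝕜 × Matrix κ κ 𝕜 =>
      pairResidual (G y.1) (P y.1) N y.2) (0, U₀, Ω₀) := by
    have hG' := ContDiffAt.comp (0, U₀, Ω₀) hG contDiffAt_fst
    have hP' := ContDiffAt.comp (0, U₀, Ω₀) hP contDiffAt_fst
    have hU : ContDiffAt 𝕜 1 (fun y : 𝕜 × Matrix ι κ 𝕜 × Matrix κ κ 𝕜 => y.2.1) (0, U₀, Ω₀) :=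
      contDiffAt_snd.fst
    have hΩ : ContDiffAt 𝕜 1 (fun y : 𝕜 × Matrix ι κ 𝕜 × Matrix κ κ 𝕜 => y.2.2) (0, U₀, Ω₀) :=
      contDiffAt_snd.snd
    have hPUΩ := contDiffAt_matrix_mul (contDiffAt_matrix_mul hP' hU) hΩ
    exact ((contDiffAt_matrix_mul hG' hU).sub hPUΩ).prodMk
      ((contDiffAt_matrix_mul contDiffAt_const hU).sub contDiffAt_const)
  obtain ⟨x, hx₀, hx', hx⟩ := exists_implicit_solution hF
    (by simp [pairResidual, h.mul_eq, h.normalized]) h.eq_zero_of_hasLineDerivAt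
  refine ⟨fun e => (x e).1, fun e => (x e).2, congrArg Prod.fst hx₀,
    congrArg Prod.snd hx₀, hx'.fst, hx'.snd, ?_⟩
  filter_upwards [hx] with e he
  exact sub_eq_zero.1 (congrArg Prod.fst he)

end Perturbation

section GradedPencil

variable {ι κ R : Type*} [CommRing R] {a b : ι → ℕ} {d : ℕ} {J K : Matrix ι ι R}

/-- Weights under which `J` is homogeneous: multiplying column `y` by `e ^ a y` and dividing row `x`
by `e ^ b x` leaves `J` unchanged and turns both `e ^ d K` and `e` into polynomials in `e`. -/
structure IsGrading (J : Matrix ι ι R) (a b : ι → ℕ) (d : ℕ) : Prop where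
  eq_of_ne_zero : ∀ {x y}, J x y ≠ 0 → a y = b x
  row_le : ∀ x, b x ≤ d
  row_le_succ : ∀ x, b x ≤ a x + 1

/-- `J + e ^ d K` with column `y` multiplied by `e ^ a y` and row `x` divided by `e ^ b x`, written
out for a `J` with `IsGrading J a b d`, so that it makes sense at `e = 0`. -/
def gradedPencil (a b : ι → ℕ) (d : ℕ) (J K : Matrix ι ι R) (e : R) : Matrix ι ι R :=
  Matrix.of fun x y => J x y + e ^ (d - b x + a y) * K x y

theorem gradedPencil_zero_apply (hbd : ∀ x, b x ≤ d) (x y : ι) :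
    gradedPencil a b d J K 0 x y = J x y + if b x = d ∧ a y = 0 then K x y else 0 := by
  have hexp : d - b x = 0 ↔ b x = d := by have := hbd x; omega
  simp [gradedPencil, zero_pow_eq, hexp]

theorem gradedPencil_zero_mul [Fintype ι] {p : Type*} [Fintype p] (hbd : ∀ x, b x ≤ d) {f : p → ι}
    (hf : Function.Injective f) (hrange : ∀ y, a y = 0 ↔ y ∈ Set.range f) (V : Matrix ι κ R)
    (x : ι) (c : κ) :
    (gradedPencil a b d J K 0 * V) x c = (J * V) x c +
      if b x = d then (K.submatrix id f * V.submatrix f id) x c else 0 := by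
  simp only [Matrix.mul_apply, gradedPencil_zero_apply hbd, add_mul, Finset.sum_add_distrib]
  congr 1
  split_ifs with hx
  · refine (Finset.sum_of_injOn f hf.injOn (by simp) (fun y _ hy => ?_) fun i _ => ?_).symm
    · have : a y ≠ 0 := fun h => hy (by simpa using (hrange y).1 h)
      simp [this]
    · simp [hx, (hrange (f i)).2 ⟨i, rfl⟩]
  · simp [hx]

variable [DecidableEq ι]

/-- `e` times the identity matrix, rescaled like `gradedPencil`. -/
def gradedMass (a b : ι → ℕ) (e : R) : Matrix ι ι R :=
  diagonal fun x => e ^ (a x + 1 - b x)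

theorem IsGrading.add_smul_mul_diagonal [Fintype ι] (h : IsGrading J a b d) (e : R) :
    (J + e ^ d • K) * diagonal (fun x => e ^ a x) =
      diagonal (fun x => e ^ b x) * gradedPencil a b d J K e := by
  ext x y
  have hJ : J x y * e ^ a y = e ^ b x * J x y := by
    by_cases hxy : J x y = 0
    · simp [hxy]
    · rw [h.eq_of_ne_zero hxy, mul_comm]
  have hpow : e ^ d = e ^ b x * e ^ (d - b x) := by
    rw [← pow_add, Nat.add_sub_cancel' (h.row_le x)]
  simp only [mul_diagonal, diagonal_mul, gradedPencil, Matrix.add_apply, Matrix.smul_apply,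
    Matrix.of_apply, smul_eq_mul]
  rw [add_mul, hJ, hpow, pow_add]
  ring

theorem IsGrading.diagonal_mul_gradedMass [Fintype ι] (h : IsGrading J a b d) (e : R) :
    diagonal (fun x => e ^ b x) * gradedMass a b e = e • diagonal (fun x => e ^ a x) := by
  rw [gradedMass, diagonal_mul_diagonal, ← diagonal_smul]
  congr 1
  funext x
  rw [← pow_add, Nat.add_sub_cancel' (h.row_le_succ x), pow_succ, Pi.smul_apply, smul_eq_mul,
    mul_comm]

theorem IsGrading.mul_eq_of_gradedPencil [Fintype ι] [Fintype κ] (h : IsGrading J a b d) {e : R}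
    {U : Matrix ι κ R} {Ω : Matrix κ κ R}
    (hU : gradedPencil a b d J K e * U = gradedMass a b e * U * Ω) :
    (J + e ^ d • K) * (diagonal (fun x => e ^ a x) * U) =
      diagonal (fun x => e ^ a x) * U * (e • Ω) := by
  rw [← Matrix.mul_assoc, h.add_smul_mul_diagonal, Matrix.mul_assoc, hU, ← Matrix.mul_assoc,
    ← Matrix.mul_assoc, h.diagonal_mul_gradedMass, Matrix.smul_mul, Matrix.smul_mul,
    Matrix.mul_smul]

open scoped Matrix.Norms.Elementwise in
theorem IsGrading.exists_perturbation {𝕜 : Type*} [RCLike 𝕜] [Fintype ι] [Fintype κ]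
    [DecidableEq κ] {J K : Matrix ι ι 𝕜} (h : IsGrading J a b d) {N : Matrix κ ι 𝕜}
    {U₀ : Matrix ι κ 𝕜} {Ω₀ : Matrix κ κ 𝕜}
    (hpair : IsSimpleDeflatingPair (gradedPencil a b d J K 0) (gradedMass a b 0) N U₀ Ω₀) :
    ∃ (U : 𝕜 → Matrix ι κ 𝕜) (Ω : 𝕜 → Matrix κ κ 𝕜), U 0 = U₀ ∧ Ω 0 = Ω₀ ∧
      DifferentiableAt 𝕜 U 0 ∧ DifferentiableAt 𝕜 Ω 0 ∧
      ∀ᶠ e in 𝓝 0, (J + e ^ d • K) * (diagonal (fun x => e ^ a x) * U e) =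
        diagonal (fun x => e ^ a x) * U e * (e • Ω e) := by
  have hG : ContDiffAt 𝕜 1 (gradedPencil a b d J K) 0 := contDiffAt_matrix.2 fun x y => by
    simp only [gradedPencil, Matrix.of_apply]
    fun_prop
  have hP : ContDiffAt 𝕜 1 (gradedMass a b) (0 : 𝕜) := contDiffAt_matrix.2 fun x y => by
    simp only [gradedMass, diagonal_apply]
    split_ifs <;> fun_prop
  obtain ⟨U, Ω, hU₀, hΩ₀, hU, hΩ, hsol⟩ := exists_deflatingPair_perturbation hG hP hpair
  exact ⟨U, Ω, hU₀, hΩ₀, hU, hΩ, hsol.mono fun e => h.mul_eq_of_gradedPencil⟩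

end GradedPencil

section ShiftRows

variable {i q r : ℕ}

/-- The block rows of `X` shifted up by one, with `w` moving in as the last block row. -/
def shiftRows (X : Matrix (Fin i × Fin q) (Fin r) ℂ) (w : Matrix (Fin q) (Fin r) ℂ) :
    Matrix (Fin i × Fin q) (Fin r) ℂ :=
  Matrix.of fun x c => if h : (x.1 : ℕ) + 1 < i then X (⟨x.1 + 1, h⟩, x.2) c else w x.2 c

theorem ext_blockRow {X Y : Matrix (Fin i × Fin q) (Fin r) ℂ}
    (h : ∀ m, blockRow X m = blockRow Y m) : X = Y :=
  Matrix.ext fun x c => congrFun (congrFun (h x.1) x.2) c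

theorem blockRow_sub (X Y : Matrix (Fin i × Fin q) (Fin r) ℂ) (m : Fin i) :
    blockRow (X - Y) m = blockRow X m - blockRow Y m :=
  rfl

theorem blockRow_shiftRows_of_lt (X : Matrix (Fin i × Fin q) (Fin r) ℂ)
    (w : Matrix (Fin q) (Fin r) ℂ) {m : Fin i} (h : (m : ℕ) + 1 < i) :
    blockRow (shiftRows X w) m = blockRow X ⟨m + 1, h⟩ := by
  ext p c
  simp [blockRow, shiftRows, h]

theorem blockRow_shiftRows_of_not_lt (X : Matrix (Fin i × Fin q) (Fin r) ℂ)
    (w : Matrix (Fin q) (Fin r) ℂ) {m : Fin i} (h : ¬ (m : ℕ) + 1 < i) :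
    blockRow (shiftRows X w) m = w := by
  ext p c
  simp [blockRow, shiftRows, h]

theorem blockCompanion_mul (hi : 1 ≤ i) (S : Matrix (Fin q) (Fin q) ℂ)
    (X : Matrix (Fin i × Fin q) (Fin r) ℂ) :
    blockCompanion i q S * X = shiftRows X (S * topRow hi X) := by
  ext ⟨m, p⟩ c
  have hzero : ∀ y : Fin i, (y : ℕ) = 0 ↔ y = ⟨0, hi⟩ := fun y => by simp [Fin.ext_iff]
  by_cases h : (m : ℕ) + 1 < i
  · have hsucc : ∀ y : Fin i, (m : ℕ) + 1 = y ↔ ⟨m + 1, h⟩ = y := fun y => by simp [Fin.ext_iff]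
    simp [blockCompanion, shiftRows, Matrix.mul_apply, Fintype.sum_prod_type, h, h.ne, hsucc,
      ite_and]
  · have hm : (m : ℕ) + 1 = i := by omega
    have hne : ∀ y : Fin i, i ≠ y := fun y => y.2.ne'
    simp [blockCompanion, shiftRows, topRow, Matrix.mul_apply, Fintype.sum_prod_type, hm, hne,
      hzero]

theorem eq_zero_of_blockCompanion_mul_eq_zero (hi : 1 ≤ i) {S : Matrix (Fin q) (Fin q) ℂ}
    (hS : IsUnit S) {X : Matrix (Fin i × Fin q) (Fin r) ℂ} (h : blockCompanion i q S * X = 0) :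
    X = 0 := by
  rw [blockCompanion_mul hi] at h
  have htop : S * topRow hi X = 0 := by
    rw [← blockRow_shiftRows_of_not_lt X (S * topRow hi X) (m := ⟨i - 1, by omega⟩)
      (by rw [Fin.val_mk]; omega), h]
    rfl
  refine ext_blockRow fun ⟨m, hm⟩ => ?_
  cases m with
  | zero =>
    calc topRow hi X = S⁻¹ * (S * topRow hi X) := by
          rw [← Matrix.mul_assoc, nonsing_inv_mul _ ((isUnit_iff_isUnit_det _).1 hS),
            Matrix.one_mul]
      _ = 0 := by rw [htop, Matrix.mul_zero]
  | succ m =>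
    rw [← blockRow_shiftRows_of_lt X (S * topRow hi X) (m := ⟨m, by omega⟩) hm, h]
    rfl

theorem isUnit_blockCompanion (hi : 1 ≤ i) {S : Matrix (Fin q) (Fin q) ℂ} (hS : IsUnit S) :
    IsUnit (blockCompanion i q S) := by
  refine mulVec_injective_iff_isUnit.1
    ((injective_iff_map_eq_zero (blockCompanion i q S).mulVecLin).2 fun v hv => ?_)
  have hcol : blockCompanion i q S * replicateCol (Fin 1) v = 0 := by
    rw [← replicateCol_mulVec, ← mulVecLin_apply, hv, replicateCol_zero]
  exact (replicateCol_eq_zero v).1 (eq_zero_of_blockCompanion_mul_eq_zero hi hS hcol)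

theorem blockRow_eq_topRow_mul_pow (hi : 1 ≤ i) {S : Matrix (Fin q) (Fin q) ℂ}
    {Φ : Matrix (Fin i × Fin q) (Fin r) ℂ} {Ω : Matrix (Fin r) (Fin r) ℂ}
    (hΦ : blockCompanion i q S * Φ = Φ * Ω) (m : Fin i) :
    blockRow Φ m = topRow hi Φ * Ω ^ (m : ℕ) := by
  obtain ⟨m, hm⟩ := m
  induction m with
  | zero => simp [blockRow, topRow]
  | succ m ih =>
    rw [← blockRow_shiftRows_of_lt Φ (S * topRow hi Φ) (m := ⟨m, by omega⟩) hm,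
      ← blockCompanion_mul, hΦ, pow_succ, ← Matrix.mul_assoc, ← ih]
    rfl

/-- The block rows `w Ω⁻ⁱ, …, w Ω⁻¹`: for invertible `Ω`, the solution of `shiftRows X w = X Ω`. -/
def chain (Ω : Matrix (Fin r) (Fin r) ℂ) (w : Matrix (Fin q) (Fin r) ℂ) :
    Matrix (Fin i × Fin q) (Fin r) ℂ :=
  Matrix.of fun x c => (w * Ω⁻¹ ^ (i - x.1)) x.2 c

theorem blockRow_chain (Ω : Matrix (Fin r) (Fin r) ℂ) (w : Matrix (Fin q) (Fin r) ℂ) (m : Fin i) :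
    blockRow (chain Ω w) m = w * Ω⁻¹ ^ (i - m) :=
  rfl

theorem shiftRows_chain {Ω : Matrix (Fin r) (Fin r) ℂ} (hΩ : IsUnit Ω)
    (w : Matrix (Fin q) (Fin r) ℂ) : shiftRows (i := i) (chain Ω w) w = chain Ω w * Ω := by
  refine ext_blockRow fun m => ?_
  have hrow : blockRow (chain Ω w * Ω) m = w * Ω⁻¹ ^ (i - (m + 1)) := by
    have hm : i - m = i - (m + 1) + 1 := by have := m.2; omega
    change blockRow (chain Ω w) m * Ω = _
    rw [blockRow_chain, hm, pow_succ, Matrix.mul_assoc, Matrix.mul_assoc,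
      nonsing_inv_mul _ ((isUnit_iff_isUnit_det _).1 hΩ), Matrix.mul_one]
  rw [hrow]
  by_cases h : (m : ℕ) + 1 < i
  · rw [blockRow_shiftRows_of_lt _ _ h, blockRow_chain]
  · rw [blockRow_shiftRows_of_not_lt _ _ h, Nat.sub_eq_zero_of_le (by omega), pow_zero,
      Matrix.mul_one]

theorem eq_chain_of_shiftRows_eq {Ω : Matrix (Fin r) (Fin r) ℂ} (hΩ : IsUnit Ω)
    {X : Matrix (Fin i × Fin q) (Fin r) ℂ} {w : Matrix (Fin q) (Fin r) ℂ}
    (h : shiftRows X w = X * Ω) : X = chain Ω w := by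
  have hrow : ∀ m, blockRow X m = blockRow (shiftRows X w) m * Ω⁻¹ := fun m => by
    rw [h]
    change _ = blockRow X m * Ω * Ω⁻¹
    rw [Matrix.mul_assoc, mul_nonsing_inv _ ((isUnit_iff_isUnit_det _).1 hΩ), Matrix.mul_one]
  suffices ∀ d, ∀ m : Fin i, i - m = d + 1 → blockRow X m = w * Ω⁻¹ ^ (d + 1) by
    refine ext_blockRow fun m => ?_
    have hm : i - m = i - m - 1 + 1 := by have := m.2; omega
    rw [blockRow_chain, hm, this _ m hm]
  intro d
  induction d with
  | zero =>
    intro m hm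
    rw [hrow, blockRow_shiftRows_of_not_lt _ _ (by omega), zero_add, pow_one]
  | succ d ih =>
    intro m hm
    have hlt : (m : ℕ) + 1 < i := by omega
    rw [hrow, blockRow_shiftRows_of_lt _ _ hlt, ih _ (by rw [Fin.val_mk]; omega),
      pow_succ _ (d + 1), Matrix.mul_assoc]

end ShiftRows

section JordanPencil

variable {k q r : ℕ} {s : ℕ → ℕ}

/-- The power of `t ^ (1 / k)` carried by each row of the perturbed invariant subspace basis. -/
def scaleExp : JIdx k s ⊕ Fin q → ℕ
  | Sum.inl x => k - x.1 + x.2.1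
  | Sum.inr _ => k

/-- The power of `t ^ (1 / k)` divided out of each row of the invariant subspace equation. -/
def rowExp : JIdx k s ⊕ Fin q → ℕ
  | Sum.inl x => k - x.1 + x.2.1 + 1
  | Sum.inr _ => k

theorem rowExp_le (x : JIdx k s ⊕ Fin q) : rowExp x ≤ k := by
  rcases x with ⟨j, m, p⟩ | z
  · have := m.2
    have := (Finset.mem_Icc.1 j.2).2
    simp only [rowExp]
    omega
  · exact le_rfl

theorem isGrading_fromBlocks (B : Matrix (Fin q) (Fin q) ℂ) :
    IsGrading (fromBlocks (nilpotentPart k s) 0 0 B) scaleExp rowExp k where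
  eq_of_ne_zero {x y} h := by
    rcases x with x | x <;> rcases y with y | y
    · obtain ⟨hj, hm, -⟩ : x.1 = y.1 ∧ (x.2.1 : ℕ) + 1 = y.2.1 ∧ (x.2.2 : ℕ) = y.2.2 := by
        by_contra hxy
        exact h (if_neg hxy)
      simp only [scaleExp, rowExp, ← hm, hj, add_assoc]
    · exact absurd rfl h
    · exact absurd rfl h
    · rfl
  row_le := rowExp_le
  row_le_succ x := by
    rcases x with _ | _
    · exact le_rfl
    · exact Nat.le_succ k

/-- The index of the first block row of the largest Jordan blocks. -/
def topIdx (hk : 1 ≤ k) (s : ℕ → ℕ) (q : ℕ) (p : Fin (s k)) : JIdx k s ⊕ Fin q :=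
  Sum.inl ⟨top hk, (firstPos (top hk), p)⟩

theorem topIdx_injective (hk : 1 ≤ k) : Function.Injective (topIdx hk s q) := fun p p' h => by
  simpa [topIdx] using h

theorem scaleExp_eq_zero_iff (hk : 1 ≤ k) (y : JIdx k s ⊕ Fin q) :
    scaleExp y = 0 ↔ y ∈ Set.range (topIdx hk s q) := by
  constructor
  · intro h
    rcases y with ⟨⟨j, hj⟩, ⟨m, hm⟩, p⟩ | z
    · have hjk := (Finset.mem_Icc.1 hj).2
      simp only [scaleExp] at h
      obtain rfl : j = k := by omega
      obtain rfl : m = 0 := by omega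
      exact ⟨p, rfl⟩
    · simp only [scaleExp] at h
      omega
  · rintro ⟨p, rfl⟩
    simp [topIdx, scaleExp, firstPos]

/-- The block rows of `V` that belong to the Jordan blocks of size `j`. -/
def jordanRows (V : Matrix (JIdx k s ⊕ Fin q) (Fin r) ℂ) (j : Finset.Icc 1 k) :
    Matrix (Fin (j : ℕ) × Fin (s j)) (Fin r) ℂ :=
  V.submatrix (fun x => Sum.inl ⟨j, x⟩) id

theorem ext_jordanRows_iff {V V' : Matrix (JIdx k s ⊕ Fin q) (Fin r) ℂ} :
    V = V' ↔ (∀ j, jordanRows V j = jordanRows V' j) ∧ V.toRows₂ = V'.toRows₂ := by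
  refine ⟨by rintro rfl; simp, fun ⟨h₁, h₂⟩ => ?_⟩
  ext (⟨j, x⟩ | z) c
  · exact congrFun (congrFun (h₁ j) x) c
  · exact congrFun (congrFun h₂ z) c

theorem jordanRows_mul (V : Matrix (JIdx k s ⊕ Fin q) (Fin r) ℂ) (Ω : Matrix (Fin r) (Fin r) ℂ)
    (j : Finset.Icc 1 k) : jordanRows (V * Ω) j = jordanRows V j * Ω :=
  rfl

theorem jordanRows_add (V V' : Matrix (JIdx k s ⊕ Fin q) (Fin r) ℂ) (j : Finset.Icc 1 k) :
    jordanRows (V + V') j = jordanRows V j + jordanRows V' j :=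
  rfl

theorem jordanRows_sub (V V' : Matrix (JIdx k s ⊕ Fin q) (Fin r) ℂ) (j : Finset.Icc 1 k) :
    jordanRows (V - V') j = jordanRows V j - jordanRows V' j :=
  rfl

theorem nilpotentPart_row (j : Finset.Icc 1 k) (m : Fin (j : ℕ)) (p : Fin (s j)) :
    nilpotentPart k s ⟨j, (m, p)⟩ =
      if h : (m : ℕ) + 1 < j then Pi.single ⟨j, (⟨m + 1, h⟩, p)⟩ 1 else 0 := by
  ext ⟨j', m', p'⟩
  have heq : ∀ h : (m : ℕ) + 1 < j,
      (⟨j', (m', p')⟩ : JIdx k s) = ⟨j, (⟨m + 1, h⟩, p)⟩ ↔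
        j = j' ∧ (m : ℕ) + 1 = m' ∧ (p : ℕ) = p' := fun h => by
    constructor
    · rintro ⟨⟩
      simp
    · rintro ⟨rfl, hm, hp⟩
      rw [show m' = ⟨m + 1, h⟩ from Fin.ext hm.symm, Fin.ext hp]
  split_ifs with h
  · simp only [nilpotentPart, Matrix.of_apply, Pi.single_apply, heq]
  · refine if_neg ?_
    rintro ⟨rfl, hm, -⟩
    exact h (hm ▸ m'.2)

theorem jordanRows_fromBlocks_mul (B : Matrix (Fin q) (Fin q) ℂ)
    (V : Matrix (JIdx k s ⊕ Fin q) (Fin r) ℂ) (j : Finset.Icc 1 k) :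
    jordanRows (fromBlocks (nilpotentPart k s) 0 0 B * V) j = shiftRows (jordanRows V j) 0 := by
  ext ⟨m, p⟩ c
  by_cases h : (m : ℕ) + 1 < j <;>
    simp [jordanRows, shiftRows, Matrix.mul_apply, Fintype.sum_sum_type, nilpotentPart_row, h,
      Pi.single_apply]

/-- The pencil of the perturbed Jordan form `diag(N, B) + e ^ k K` in the rescaled coordinates. -/
abbrev jordanPencil (B : Matrix (Fin q) (Fin q) ℂ)
    (K : Matrix (JIdx k s ⊕ Fin q) (JIdx k s ⊕ Fin q) ℂ) (e : ℂ) :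
    Matrix (JIdx k s ⊕ Fin q) (JIdx k s ⊕ Fin q) ℂ :=
  gradedPencil scaleExp rowExp k (fromBlocks (nilpotentPart k s) 0 0 B) K e

/-- `e` times the identity matrix, in the rescaled coordinates of `jordanPencil`. -/
abbrev jordanMass (k : ℕ) (s : ℕ → ℕ) (q : ℕ) (e : ℂ) :
    Matrix (JIdx k s ⊕ Fin q) (JIdx k s ⊕ Fin q) ℂ :=
  gradedMass scaleExp rowExp e

variable (hk : 1 ≤ k) {B : Matrix (Fin q) (Fin q) ℂ}
  {K : Matrix (JIdx k s ⊕ Fin q) (JIdx k s ⊕ Fin q) ℂ}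

theorem jordanRows_jordanPencil_zero_mul (V : Matrix (JIdx k s ⊕ Fin q) (Fin r) ℂ)
    (j : Finset.Icc 1 k) :
    jordanRows (jordanPencil B K 0 * V) j = shiftRows (jordanRows V j) (blockRow (jordanRows
      (K.submatrix id (topIdx hk s q) * V.submatrix (topIdx hk s q) id) j) (lastPos j)) := by
  ext ⟨m, p⟩ c
  have hrow := gradedPencil_zero_mul (K := K) (J := fromBlocks (nilpotentPart k s) 0 0 B)
    rowExp_le (topIdx_injective hk) (scaleExp_eq_zero_iff hk) V (Sum.inl ⟨j, (m, p)⟩) c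
  refine hrow.trans ?_
  have hJ := congrFun (congrFun (jordanRows_fromBlocks_mul B V j) (m, p)) c
  rw [show (fromBlocks (nilpotentPart k s) 0 0 B * V) (Sum.inl ⟨j, (m, p)⟩) c = _ from hJ]
  have hm := m.2
  have hj := (Finset.mem_Icc.1 j.2).2
  by_cases h : (m : ℕ) + 1 < j
  · have hlt : rowExp (Sum.inl ⟨j, (m, p)⟩ : JIdx k s ⊕ Fin q) ≠ k := by
      simp only [rowExp]
      omega
    simp [shiftRows, h, hlt]
  · have heq : rowExp (Sum.inl ⟨j, (m, p)⟩ : JIdx k s ⊕ Fin q) = k := by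
      simp only [rowExp]
      omega
    have hlast : m = lastPos j := Fin.ext (by simp only [lastPos]; omega)
    simp [shiftRows, h, heq, ← hlast, blockRow, jordanRows]

theorem toRows₂_jordanPencil_zero_mul (V : Matrix (JIdx k s ⊕ Fin q) (Fin r) ℂ) :
    (jordanPencil B K 0 * V).toRows₂ = B * V.toRows₂ +
      (K.submatrix id (topIdx hk s q) * V.submatrix (topIdx hk s q) id).toRows₂ := by
  ext z c
  refine (gradedPencil_zero_mul rowExp_le (topIdx_injective hk) (scaleExp_eq_zero_iff hk) V
    (Sum.inr z) c).trans ?_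
  simp [rowExp, Matrix.mul_apply, Fintype.sum_sum_type]

theorem jordanRows_jordanMass_zero_mul (V : Matrix (JIdx k s ⊕ Fin q) (Fin r) ℂ)
    (j : Finset.Icc 1 k) : jordanRows (jordanMass k s q 0 * V) j = jordanRows V j := by
  ext x c
  simp [jordanRows, gradedMass, scaleExp, rowExp]

theorem toRows₂_jordanMass_zero_mul (V : Matrix (JIdx k s ⊕ Fin q) (Fin r) ℂ) :
    (jordanMass k s q 0 * V).toRows₂ = 0 := by
  ext z c
  simp [gradedMass, scaleExp, rowExp]

theorem jordanPencil_zero_mul_eq_iff {V X : Matrix (JIdx k s ⊕ Fin q) (Fin r) ℂ} :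
    jordanPencil B K 0 * V = jordanMass k s q 0 * X ↔
      (∀ j, shiftRows (jordanRows V j) (blockRow (jordanRows
        (K.submatrix id (topIdx hk s q) * V.submatrix (topIdx hk s q) id) j) (lastPos j)) =
          jordanRows X j) ∧
      B * V.toRows₂ +
        (K.submatrix id (topIdx hk s q) * V.submatrix (topIdx hk s q) id).toRows₂ = 0 := by
  simp only [ext_jordanRows_iff, jordanRows_jordanPencil_zero_mul hk,
    toRows₂_jordanPencil_zero_mul hk, jordanRows_jordanMass_zero_mul, toRows₂_jordanMass_zero_mul]

/-- The block of `K` that couples the first to the last block row of the largest Jordan blocks. -/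
def topBlock (K : Matrix (JIdx k s ⊕ Fin q) (JIdx k s ⊕ Fin q) ℂ) :
    Matrix (Fin (s k)) (Fin (s k)) ℂ :=
  K.submatrix (fun p => Sum.inl ⟨top hk, (lastPos (top hk), p)⟩) (topIdx hk s q)

theorem blockRow_jordanRows_top_lastPos (Q : Matrix (Fin (s k)) (Fin r) ℂ) :
    blockRow (jordanRows (K.submatrix id (topIdx hk s q) * Q) (top hk)) (lastPos (top hk)) =
      topBlock hk K * Q :=
  rfl

theorem blockCompanion_mul_jordanRows_top {V X : Matrix (JIdx k s ⊕ Fin q) (Fin r) ℂ}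
    (h : jordanPencil B K 0 * V = jordanMass k s q 0 * X) :
    blockCompanion k (s k) (topBlock hk K) * jordanRows V (top hk) = jordanRows X (top hk) := by
  rw [blockCompanion_mul hk]
  exact ((jordanPencil_zero_mul_eq_iff hk).1 h).1 (top hk)

/-- The solution `V` of `jordanPencil B K 0 * V = jordanMass k s q 0 * V * Ω` that belongs
to the first block row `Q` of a solution of `blockCompanion * Φ = Φ * Ω`: its Jordan rows are chains
driven by `K`, and its complementary rows solve a linear system with matrix `B`. -/
def limitSolution (B : Matrix (Fin q) (Fin q) ℂ)
    (K : Matrix (JIdx k s ⊕ Fin q) (JIdx k s ⊕ Fin q) ℂ) (Ω : Matrix (Fin r) (Fin r) ℂ)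
    (Q : Matrix (Fin (s k)) (Fin r) ℂ) : Matrix (JIdx k s ⊕ Fin q) (Fin r) ℂ :=
  fromRows
    (Matrix.of fun x => chain Ω (blockRow (jordanRows (K.submatrix id (topIdx hk s q) * Q) x.1)
      (lastPos x.1)) x.2)
    (-(B⁻¹ * (K.submatrix id (topIdx hk s q) * Q).toRows₂))

theorem jordanRows_limitSolution (Ω : Matrix (Fin r) (Fin r) ℂ) (Q : Matrix (Fin (s k)) (Fin r) ℂ)
    (j : Finset.Icc 1 k) :
    jordanRows (limitSolution hk B K Ω Q) j =
      chain Ω (blockRow (jordanRows (K.submatrix id (topIdx hk s q) * Q) j) (lastPos j)) :=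
  rfl

variable {Ω : Matrix (Fin r) (Fin r) ℂ} {Φ : Matrix (Fin k × Fin (s k)) (Fin r) ℂ}

theorem jordanRows_limitSolution_top (hΩ : IsUnit Ω)
    (hΦ : blockCompanion k (s k) (topBlock hk K) * Φ = Φ * Ω) :
    jordanRows (limitSolution hk B K Ω (topRow hk Φ)) (top hk) = Φ := by
  rw [jordanRows_limitSolution, blockRow_jordanRows_top_lastPos]
  rw [blockCompanion_mul hk] at hΦ
  exact (eq_chain_of_shiftRows_eq hΩ hΦ).symm

theorem jordanPencil_zero_mul_limitSolution (hB : IsUnit B) (hΩ : IsUnit Ω)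
    (hΦ : blockCompanion k (s k) (topBlock hk K) * Φ = Φ * Ω) :
    jordanPencil B K 0 * limitSolution hk B K Ω (topRow hk Φ) =
      jordanMass k s q 0 * limitSolution hk B K Ω (topRow hk Φ) * Ω := by
  have htop : (limitSolution hk B K Ω (topRow hk Φ)).submatrix (topIdx hk s q) id = topRow hk Φ :=
    congrArg (topRow hk) (jordanRows_limitSolution_top (B := B) hk hΩ hΦ)
  rw [Matrix.mul_assoc, jordanPencil_zero_mul_eq_iff hk, htop]
  refine ⟨fun j => shiftRows_chain hΩ _, ?_⟩
  rw [limitSolution, toRows₂_fromRows, Matrix.mul_neg, ← Matrix.mul_assoc,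
    mul_nonsing_inv _ ((isUnit_iff_isUnit_det _).1 hB), Matrix.one_mul, neg_add_cancel]

theorem eq_zero_of_jordanRows_top_eq_zero (hB : IsUnit B) (hΩ : IsUnit Ω)
    {V : Matrix (JIdx k s ⊕ Fin q) (Fin r) ℂ}
    (hV : jordanPencil B K 0 * V = jordanMass k s q 0 * (V * Ω))
    (htop : jordanRows V (top hk) = 0) : V = 0 := by
  have hQ : V.submatrix (topIdx hk s q) id = 0 := congrArg (topRow hk) htop
  rw [jordanPencil_zero_mul_eq_iff hk, hQ, Matrix.mul_zero] at hV
  refine ext_jordanRows_iff.2 ⟨fun j => ?_, ?_⟩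
  · refine (eq_chain_of_shiftRows_eq hΩ (hV.1 j)).trans (ext_blockRow fun m => ?_)
    rw [blockRow_chain]
    exact Matrix.zero_mul _
  · calc V.toRows₂ = B⁻¹ * (B * V.toRows₂ + 0) := by
          rw [add_zero, ← Matrix.mul_assoc, nonsing_inv_mul _ ((isUnit_iff_isUnit_det _).1 hB),
            Matrix.one_mul]
      _ = 0 := (congrArg (B⁻¹ * ·) hV.2).trans (Matrix.mul_zero _)

theorem isSimpleDeflatingPair_limitSolution (hB : IsUnit B) (hΩ : IsUnit Ω)
    {L : Matrix (Fin r) (Fin k × Fin (s k)) ℂ}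
    (h : IsSimpleDeflatingPair (blockCompanion k (s k) (topBlock hk K)) 1 L Φ Ω) :
    IsSimpleDeflatingPair (jordanPencil B K 0) (jordanMass k s q 0)
      (L * (1 : Matrix (JIdx k s ⊕ Fin q) (JIdx k s ⊕ Fin q) ℂ).submatrix
        (fun x => Sum.inl ⟨top hk, x⟩) id)
      (limitSolution hk B K Ω (topRow hk Φ)) Ω := by
  have hΦ : blockCompanion k (s k) (topBlock hk K) * Φ = Φ * Ω := by simpa using h.mul_eq
  have hN : ∀ V : Matrix (JIdx k s ⊕ Fin q) (Fin r) ℂ,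
      L * (1 : Matrix (JIdx k s ⊕ Fin q) (JIdx k s ⊕ Fin q) ℂ).submatrix
        (fun x => Sum.inl ⟨top hk, x⟩) id * V = L * jordanRows V (top hk) := fun V =>
    (Matrix.mul_assoc _ _ _).trans (congrArg (L * ·) (one_submatrix_mul _ (Equiv.refl _) V))
  have htop := jordanRows_limitSolution_top (B := B) hk hΩ hΦ
  refine ⟨jordanPencil_zero_mul_limitSolution hk hB hΩ hΦ, ?_, fun V C hV hNV => ?_⟩
  · rw [hN, htop, h.normalized]
  · rw [hN] at hNV
    have hV' : jordanPencil B K 0 * V =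
        jordanMass k s q 0 * (V * Ω + limitSolution hk B K Ω (topRow hk Φ) * C) := by
      rw [hV, Matrix.mul_add, Matrix.mul_assoc, Matrix.mul_assoc]
    have hΘ := blockCompanion_mul_jordanRows_top hk hV'
    rw [jordanRows_add, jordanRows_mul, jordanRows_mul, htop] at hΘ
    obtain ⟨hVtop, rfl⟩ := h.injective _ _ (by simpa using hΘ) hNV
    rw [Matrix.mul_zero, add_zero] at hV'
    exact ⟨eq_zero_of_jordanRows_top_eq_zero hk hB hΩ hV' hVtop, rfl⟩

end JordanPencil

section Assembly

variable {n k q r : ℕ} {s : ℕ → ℕ}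

/-- The change from the rescaled coordinates of `jordanPencil` to the basis `[Xi Xic]`. -/
abbrev jordanScaling (k : ℕ) (s : ℕ → ℕ) (q : ℕ) (e : ℂ) :
    Matrix (JIdx k s ⊕ Fin q) (JIdx k s ⊕ Fin q) ℂ :=
  diagonal fun x => e ^ scaleExp x

theorem exists_jordan_perturbation (hk : 1 ≤ k) {B : Matrix (Fin q) (Fin q) ℂ} (hB : IsUnit B)
    {K : Matrix (JIdx k s ⊕ Fin q) (JIdx k s ⊕ Fin q) ℂ} {Ω : Matrix (Fin r) (Fin r) ℂ}
    (hΩ : IsUnit Ω) {Φ : Matrix (Fin k × Fin (s k)) (Fin r) ℂ} (hrank : Φ.rank = r)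
    (hΦ : blockCompanion k (s k) (topBlock hk K) * Φ = Φ * Ω)
    (hroots : ∀ μ ∈ Ω.charpoly.roots,
      μ ∉ (blockCompanion k (s k) (topBlock hk K)).charpoly.roots - Ω.charpoly.roots) :
    ∃ (U : ℂ → Matrix (JIdx k s ⊕ Fin q) (Fin r) ℂ) (Ω' : ℂ → Matrix (Fin r) (Fin r) ℂ),
      jordanRows (U 0) (top hk) = Φ ∧ Ω' 0 = Ω ∧
      (∀ x c, DifferentiableAt ℂ (fun e => U e x c) 0) ∧
      (∀ a c, DifferentiableAt ℂ (fun e => Ω' e a c) 0) ∧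
      ∀ᶠ e in 𝓝 0, (fromBlocks (nilpotentPart k s) 0 0 B + e ^ k • K) *
          (jordanScaling k s q e * U e) =
        jordanScaling k s q e * U e * (e • Ω' e) := by
  obtain ⟨L, hL⟩ := exists_isSimpleDeflatingPair (by simpa using hrank) hΦ hroots
  obtain ⟨U, Ω', hU₀, hΩ₀, hU, hΩ', hsol⟩ := (isGrading_fromBlocks B).exists_perturbation
    (isSimpleDeflatingPair_limitSolution hk hB hΩ hL)
  refine ⟨U, Ω', ?_, hΩ₀, fun x => differentiableAt_pi.1 (differentiableAt_pi.1 hU x),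
    fun a => differentiableAt_pi.1 (differentiableAt_pi.1 hΩ' a), hsol⟩
  rw [hU₀, jordanRows_limitSolution_top hk hΩ hΦ]

theorem add_smul_mul_eq_of_coordinates {ι κ R : Type*} [CommRing R] [Fintype ι] [DecidableEq ι]
    [Fintype κ] [DecidableEq κ] {m : Type*} [Fintype m] [DecidableEq m] {A D : Matrix ι ι R}
    {P : Matrix ι m R} {P' : Matrix m ι R} {J : Matrix m m R} {Y : Matrix m κ R} {C : Matrix κ κ R}
    {l c : R} (hP : P * P' = 1) (hA : A * P = P * (l • 1 + J))
    (hY : (J + c • (P' * D * P)) * Y = Y * C) :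
    (A + c • D) * (P * Y) = P * Y * (l • 1 + C) := by
  have hD : D * P = P * (P' * D * P) := by
    rw [← Matrix.mul_assoc, ← Matrix.mul_assoc, hP, Matrix.one_mul]
  calc (A + c • D) * (P * Y) = P * ((l • 1 + J + c • (P' * D * P)) * Y) := by
        rw [← Matrix.mul_assoc, Matrix.add_mul, Matrix.smul_mul, hA, hD, ← Matrix.mul_smul,
          ← Matrix.mul_add, Matrix.mul_assoc]
    _ = P * (l • Y + Y * C) := by
        rw [add_assoc, Matrix.add_mul, hY, Matrix.smul_mul, Matrix.one_mul]
    _ = P * Y * (l • 1 + C) := by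
        rw [Matrix.mul_assoc, Matrix.mul_add Y, Matrix.mul_smul, Matrix.mul_one]

theorem fromBlocks_smul_one_add {ι m R : Type*} [DecidableEq ι] [DecidableEq m] [Ring R] (l : R)
    (N : Matrix ι ι R) (A : Matrix m m R) :
    fromBlocks (l • 1 + N) 0 0 A = l • 1 + fromBlocks N 0 0 (A - l • 1) := by
  rw [← fromBlocks_one, fromBlocks_smul, fromBlocks_add]
  simp

theorem isUnit_sub_smul_one {R S : Type*} [CommRing R] [Ring S] [Algebra R S] {a : S} {l : R}
    (hl : l ∉ spectrum R a) : IsUnit (a - l • 1) := by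
  have h := (spectrum.notMem_iff.1 hl).neg
  rwa [neg_sub, Algebra.algebraMap_eq_smul_one] at h

theorem topBlock_conjTranspose_mul_mul (hk : 1 ≤ k) (D : Matrix (Fin n) (Fin n) ℂ)
    (Xi Sg : Matrix (Fin n) (JIdx k s) ℂ) (Xic Sgc : Matrix (Fin n) (Fin q) ℂ) :
    topBlock hk ((fromCols Sg Sgc)ᴴ * D * fromCols Xi Xic) = topS hk D Xi Sg :=
  rfl

theorem isUnit_topS (hk : 1 ≤ k) {D : Matrix (Fin n) (Fin n) ℂ}
    {Xi Sg : Matrix (Fin n) (JIdx k s) ℂ} (hW : IsUnit (W D Xi Sg (top hk))) :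
    IsUnit (topS hk D Xi Sg) := by
  let f : Fin (s k) → EIdx k s (top hk) := fun p => ⟨⟨top hk, le_rfl⟩, p⟩
  have hf : Function.Bijective f := by
    constructor
    · intro p p' h
      simpa [f] using h
    · rintro ⟨⟨⟨j, hj⟩, hkj⟩, p⟩
      obtain rfl : j = k := le_antisymm (Finset.mem_Icc.1 hj).2 hkj
      exact ⟨p, rfl⟩
  exact (isUnit_submatrix_equiv (Equiv.ofBijective f hf) (Equiv.ofBijective f hf)).2 hW

/-- The coefficient matrix, in the basis `[Xi Xic]`, of the leading term `Xi_{k1} Q`. -/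
def leadRows (hk : 1 ≤ k) (s : ℕ → ℕ) (q : ℕ) (Q : Matrix (Fin (s k)) (Fin r) ℂ) :
    Matrix (JIdx k s ⊕ Fin q) (Fin r) ℂ :=
  (1 : Matrix (JIdx k s ⊕ Fin q) (JIdx k s ⊕ Fin q) ℂ).submatrix id (topIdx hk s q) * Q

theorem fromCols_mul_leadRows (hk : 1 ≤ k) (Xi : Matrix (Fin n) (JIdx k s) ℂ)
    (Xic : Matrix (Fin n) (Fin q) ℂ) (Q : Matrix (Fin (s k)) (Fin r) ℂ) :
    fromCols Xi Xic * leadRows hk s q Q = subCol Xi (top hk) (firstPos (top hk)) * Q := by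
  rw [leadRows, ← Matrix.mul_assoc]
  congr 1
  ext a p
  simp [Matrix.mul_apply, Matrix.one_apply, subCol, topIdx]

theorem blockRow_jordanRows_leadRows (hk : 1 ≤ k) (Q : Matrix (Fin (s k)) (Fin r) ℂ)
    {i : Finset.Icc 1 k} (hi : (i : ℕ) < k) (m : Fin (i : ℕ)) :
    blockRow (jordanRows (leadRows hk s q Q) i) m = 0 := by
  have hne : i ≠ top hk := fun h => hi.ne (congrArg Subtype.val h)
  ext p c
  simp [blockRow, jordanRows, leadRows, topIdx, Matrix.mul_apply, Matrix.one_apply, hne]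

theorem blockRow_jordanRows_leadRows_top (hk : 1 ≤ k) (Q : Matrix (Fin (s k)) (Fin r) ℂ)
    (m : Fin k) :
    blockRow (jordanRows (leadRows hk s q Q) (top hk)) m = if (m : ℕ) = 0 then Q else 0 := by
  have hfirst : m = firstPos (top hk) ↔ (m : ℕ) = 0 := Fin.ext_iff
  ext p c
  by_cases hm : (m : ℕ) = 0 <;>
    simp [blockRow, jordanRows, leadRows, topIdx, Matrix.mul_apply, Matrix.one_apply, hm, hfirst]

theorem toRows₂_leadRows (hk : 1 ≤ k) (Q : Matrix (Fin (s k)) (Fin r) ℂ) :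
    (leadRows hk s q Q).toRows₂ = 0 := by
  ext z c
  simp [leadRows, topIdx, Matrix.mul_apply, Matrix.one_apply]

theorem blockRow_jordanRows_jordanScaling_mul (e : ℂ) (U : Matrix (JIdx k s ⊕ Fin q) (Fin r) ℂ)
    (i : Finset.Icc 1 k) (m : Fin (i : ℕ)) :
    blockRow (jordanRows (jordanScaling k s q e * U) i) m =
      e ^ (k - i + m) • blockRow (jordanRows U i) m := by
  ext p c
  simp [blockRow, jordanRows, jordanScaling, scaleExp, diagonal_mul]

theorem toRows₂_jordanScaling_mul (e : ℂ) (U : Matrix (JIdx k s ⊕ Fin q) (Fin r) ℂ) :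
    (jordanScaling k s q e * U).toRows₂ = e ^ k • U.toRows₂ := by
  ext z c
  simp [jordanScaling, scaleExp, diagonal_mul]

theorem fromCols_mul_eq_sum (Xi : Matrix (Fin n) (JIdx k s) ℂ) (Xic : Matrix (Fin n) (Fin q) ℂ)
    (Z : Matrix (JIdx k s ⊕ Fin q) (Fin r) ℂ) :
    fromCols Xi Xic * Z = ∑ i, blockCol Xi i * jordanRows Z i + Xic * Z.toRows₂ := by
  ext a c
  simp [Matrix.mul_apply, Fintype.sum_sum_type, Fintype.sum_sigma, Matrix.sum_apply, blockCol,
    jordanRows]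

/-- `t ^ (1 / k)`, as a complex number. -/
abbrev root (k : ℕ) (t : ℝ) : ℂ :=
  ((t ^ (1 / (k : ℝ)) : ℝ) : ℂ)

theorem tendsto_root (hk : 1 ≤ k) : Tendsto (root k) (𝓝[>] 0) (𝓝 0) := by
  have hpos : (0 : ℝ) < 1 / (k : ℝ) := by positivity
  have h := (Real.continuousAt_rpow_const 0 (1 / (k : ℝ)) (Or.inr hpos.le)).tendsto
  rw [Real.zero_rpow hpos.ne'] at h
  exact (Complex.continuous_ofReal.tendsto' 0 0 Complex.ofReal_zero).comp
    (h.mono_left nhdsWithin_le_nhds)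

theorem root_pow (hk : 1 ≤ k) {t : ℝ} (ht : 0 ≤ t) : root k t ^ k = t := by
  rw [root, ← Complex.ofReal_pow, one_div, Real.rpow_inv_natCast_pow ht (by omega)]

theorem norm_root_pow {t : ℝ} (ht : 0 ≤ t) (m : ℕ) : ‖root k t ^ m‖ = t ^ ((m : ℝ) / k) := by
  rw [norm_pow, Complex.norm_real, Real.norm_of_nonneg (Real.rpow_nonneg ht _),
    ← Real.rpow_mul_natCast ht, one_div_mul_eq_div]

theorem matBigO_root_pow_smul {ι κ : Type*} (hk : 1 ≤ k) {F : ℂ → Matrix ι κ ℂ} (l m : ℕ)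
    (hF : ∀ a b, (fun e => F e a b) =O[𝓝 0] fun e => e ^ m) :
    MatBigO (fun t => root k t ^ l • F (root k t)) (((l : ℝ) + m) / k) := fun a b => by
  have h := (isBigO_refl (fun t => root k t ^ l) _).mul ((hF a b).comp_tendsto (tendsto_root hk))
  refine (h.trans (.of_norm_eventuallyLE ?_) :)
  filter_upwards [self_mem_nhdsWithin] with t ht
  rw [Function.comp_apply, ← pow_add, norm_root_pow (le_of_lt ht), Nat.cast_add]

theorem matBigO_of_continuousAt {ι κ : Type*} (hk : 1 ≤ k) {F : ℂ → Matrix ι κ ℂ}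
    (hF : ∀ a b, ContinuousAt (fun e => F e a b) 0) (l : ℕ) :
    MatBigO (fun t => root k t ^ l • F (root k t)) ((l : ℝ) / k) := by
  simpa using matBigO_root_pow_smul hk l 0 fun a b => by
    simpa using (hF a b).tendsto.isBigO_one ℂ

theorem matBigO_of_differentiableAt {ι κ : Type*} (hk : 1 ≤ k) {F : ℂ → Matrix ι κ ℂ}
    (hF : ∀ a b, DifferentiableAt ℂ (fun e => F e a b) 0) (l : ℕ) :
    MatBigO (fun t => root k t ^ l • (F (root k t) - F 0)) (((l : ℝ) + 1) / k) := by
  simpa using matBigO_root_pow_smul hk (F := fun e => F e - F 0) l 1 fun a b => by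
    simpa using (hF a b).isBigO_sub

variable (hk : 1 ≤ k) {U : ℂ → Matrix (JIdx k s ⊕ Fin q) (Fin r) ℂ}

theorem matBigO_blockRow_of_lt (hU : ∀ x c, ContinuousAt (fun e => U e x c) 0)
    (Q : Matrix (Fin (s k)) (Fin r) ℂ) {i : Finset.Icc 1 k} (hi : (i : ℕ) < k) (m : Fin (i : ℕ)) :
    MatBigO (fun t => blockRow (jordanRows
      (jordanScaling k s q (root k t) * U (root k t) - leadRows hk s q Q) i) m)
      (1 - ((i : ℝ) - (m : ℝ)) / (k : ℝ)) := by
  have hexp : 1 - ((i : ℝ) - (m : ℝ)) / (k : ℝ) = ((k - i + m : ℕ) : ℝ) / k := by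
    have : (k : ℝ) ≠ 0 := by positivity
    push_cast [Nat.cast_sub hi.le]
    field_simp
    ring
  simp only [jordanRows_sub, blockRow_sub, blockRow_jordanRows_leadRows hk Q hi, sub_zero,
    blockRow_jordanRows_jordanScaling_mul, hexp]
  exact matBigO_of_continuousAt hk (F := fun e => blockRow (jordanRows (U e) i) m)
    (fun p c => hU (Sum.inl ⟨i, (m, p)⟩) c) _

theorem matBigO_blockRow_top (hU : ∀ x c, DifferentiableAt ℂ (fun e => U e x c) 0)
    {S : Matrix (Fin (s k)) (Fin (s k)) ℂ} {Φ : Matrix (Fin k × Fin (s k)) (Fin r) ℂ}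
    {Ω : Matrix (Fin r) (Fin r) ℂ} (hU₀ : jordanRows (U 0) (top hk) = Φ)
    (hΦ : blockCompanion k (s k) S * Φ = Φ * Ω) (m : Fin k) :
    MatBigO (fun t => blockRow (jordanRows (jordanScaling k s q (root k t) * U (root k t) -
        leadRows hk s q (topRow hk Φ)) (top hk)) m -
          if (m : ℕ) = 0 then 0 else topRow hk Φ * (root k t • Ω) ^ (m : ℕ))
      (((m : ℝ) + 1) / (k : ℝ)) := by
  have hlead : ∀ e : ℂ, ((if (m : ℕ) = 0 then topRow hk Φ else 0) +
      if (m : ℕ) = 0 then 0 else topRow hk Φ * (e • Ω) ^ (m : ℕ)) =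
        e ^ (m : ℕ) • blockRow (jordanRows (U 0) (top hk)) m := fun e => by
    rw [hU₀, blockRow_eq_topRow_mul_pow hk hΦ]
    split_ifs with hm
    · simp [hm]
    · rw [zero_add, smul_pow, Matrix.mul_smul]
  have hrow : ∀ e : ℂ, blockRow (jordanRows (jordanScaling k s q e * U e) (top hk)) m =
      e ^ (m : ℕ) • blockRow (jordanRows (U e) (top hk)) m := fun e => by
    rw [blockRow_jordanRows_jordanScaling_mul, Nat.sub_self, zero_add]
  simp only [jordanRows_sub, blockRow_sub]
  simp only [blockRow_jordanRows_leadRows_top, sub_sub, hlead, hrow, ← smul_sub]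
  exact matBigO_of_differentiableAt hk (F := fun e => blockRow (jordanRows (U e) (top hk)) m)
    (fun p c => hU (Sum.inl ⟨top hk, (m, p)⟩) c) m

theorem matBigO_mul_toRows₂ (hU : ∀ x c, ContinuousAt (fun e => U e x c) 0)
    (Xic : Matrix (Fin n) (Fin q) ℂ) (Q : Matrix (Fin (s k)) (Fin r) ℂ) :
    MatBigO (fun t => Xic *
      (jordanScaling k s q (root k t) * U (root k t) - leadRows hk s q Q).toRows₂) 1 := by
  have hrow : ∀ e : ℂ, Xic * (jordanScaling k s q e * U e - leadRows hk s q Q).toRows₂ =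
      e ^ k • (Xic * (U e).toRows₂) := fun e => by
    rw [← Matrix.mul_smul, ← toRows₂_jordanScaling_mul,
      ← sub_zero (toRows₂ (jordanScaling k s q e * U e)), ← toRows₂_leadRows hk Q]
    rfl
  have hcont : ∀ a c, ContinuousAt (fun e => (Xic * (U e).toRows₂) a c) 0 := fun a c => by
    simp only [Matrix.mul_apply, toRows₂_apply]
    exact tendsto_finsetSum _ fun z _ => (hU (Sum.inr z) c).tendsto.const_mul _
  have hexp : (k : ℝ) / k = 1 := div_self (by positivity)
  simpa only [hrow, hexp] using matBigO_of_continuousAt hk hcont k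

end Assembly

end JordanPert

end

open JordanPert Matrix in
theorem corollary3p5_general {n k q r : ℕ} (hk : 1 ≤ k) (s : ℕ → ℕ)
    (A D : Matrix (Fin n) (Fin n) ℂ) (lam0 : ℂ)
    (Xi Sg : Matrix (Fin n) (JIdx k s) ℂ) (Xic Sgc : Matrix (Fin n) (Fin q) ℂ)
    (A22 : Matrix (Fin q) (Fin q) ℂ)
    (hinv_right : fromCols Xi Xic * (fromCols Sg Sgc)ᴴ = 1)
    (hA : A * fromCols Xi Xic =
      fromCols Xi Xic * fromBlocks (lam0 • 1 + nilpotentPart k s) 0 0 A22)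
    (hA22 : lam0 ∉ spectrum ℂ A22)
    (Omega : Matrix (Fin r) (Fin r) ℂ) (hOmega_isUnit : IsUnit Omega)
    (Phi : Matrix (Fin k × Fin (s k)) (Fin r) ℂ) (hPhi_rank : Phi.rank = r)
    (hPhi : blockCompanion k (s k) (topS hk D Xi Sg) * Phi = Phi * Omega)
    (hOmega : ∀ μ ∈ Omega.charpoly.roots,
      μ ∉ (blockCompanion k (s k) (topS hk D Xi Sg)).charpoly.roots - Omega.charpoly.roots) :
    ∃ (C : ℝ → Matrix (Fin r) (Fin r) ℂ) (H : ℝ → Matrix (Fin n) (Fin r) ℂ)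
      (Hb : (i : Finset.Icc 1 k) → ℝ → Matrix (Fin (i : ℕ) × Fin (s i)) (Fin r) ℂ)
      (E : ℝ → Matrix (Fin n) (Fin r) ℂ),
      (∀ᶠ t : ℝ in 𝓝[>] 0, (A + (t : ℂ) • D) * H t = H t * C t) ∧
      MatBigO (fun t => C t - (lam0 • 1 + ((t ^ (1 / (k : ℝ)) : ℝ) : ℂ) • Omega)) (2 / (k : ℝ)) ∧
      (∀ᶠ t : ℝ in 𝓝[>] 0,
        H t = subCol Xi (top hk) (firstPos (top hk)) * topRow hk Phi
          + ∑ i : Finset.Icc 1 k, blockCol Xi i * Hb i t + E t) ∧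
      MatBigO E 1 ∧
      (∀ i : Finset.Icc 1 k, (i : ℕ) < k → ∀ m : Fin (i : ℕ),
        MatBigO (fun t => blockRow (Hb i t) m) (1 - ((i : ℝ) - (m : ℝ)) / (k : ℝ))) ∧
      (∀ m : Fin k,
        MatBigO (fun t => blockRow (Hb (top hk) t) m -
            (if (m : ℕ) = 0 then 0
              else topRow hk Phi * (((t ^ (1 / (k : ℝ)) : ℝ) : ℂ) • Omega) ^ (m : ℕ)))
          (((m : ℝ) + 1) / (k : ℝ))) := by
  rw [fromBlocks_smul_one_add] at hA
  rw [← topBlock_conjTranspose_mul_mul hk D Xi Sg Xic Sgc] at hPhi hOmega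
  obtain ⟨U, Ω, hU₀, hΩ₀, hU, hΩ, hsol⟩ := exists_jordan_perturbation hk
    (isUnit_sub_smul_one hA22) hOmega_isUnit hPhi_rank hPhi hOmega
  have hU' := fun x c => (hU x c).continuousAt
  let Y : ℝ → Matrix (JIdx k s ⊕ Fin q) (Fin r) ℂ := fun t =>
    jordanScaling k s q (root k t) * U (root k t)
  let Z : ℝ → Matrix (JIdx k s ⊕ Fin q) (Fin r) ℂ := fun t =>
    Y t - leadRows hk s q (topRow hk Phi)
  refine ⟨fun t => lam0 • 1 + root k t • Ω (root k t), fun t => fromCols Xi Xic * Y t,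
    fun i t => jordanRows (Z t) i, fun t => Xic * (Z t).toRows₂, ?_, ?_, .of_forall fun t => ?_,
    matBigO_mul_toRows₂ hk hU' Xic _, fun i hi m => matBigO_blockRow_of_lt hk hU' _ hi m,
    matBigO_blockRow_top hk hU hU₀ hPhi⟩
  · filter_upwards [(tendsto_root hk).eventually hsol, self_mem_nhdsWithin] with t hY ht
    rw [root_pow hk (le_of_lt ht)] at hY
    exact add_smul_mul_eq_of_coordinates hinv_right hA hY
  · have hΩ_bound := matBigO_of_differentiableAt hk hΩ 1
    simpa only [hΩ₀, pow_one, Nat.cast_one, one_add_one_eq_two, smul_sub,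
      add_sub_add_left_eq_sub] using hΩ_bound
  · rw [add_assoc, ← fromCols_mul_eq_sum, ← fromCols_mul_leadRows hk Xi Xic, ← Matrix.mul_add,
      add_sub_cancel]

open JordanPert Matrix in
theorem corollary3p5 {n k q r : ℕ} (hk : 1 ≤ k) (s : ℕ → ℕ) (hs : 0 < s k)
    (A D : Matrix (Fin n) (Fin n) ℂ) (lam0 : ℂ)
    (Xi Sg : Matrix (Fin n) (JIdx k s) ℂ) (Xic Sgc : Matrix (Fin n) (Fin q) ℂ)
    (A22 : Matrix (Fin q) (Fin q) ℂ)
    -- `[Xi Xic]` is invertible and `[Sg Sgc]` is its inverse conjugate transpose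
    (hinv_left : (fromCols Sg Sgc)ᴴ * fromCols Xi Xic = 1)
    (hinv_right : fromCols Xi Xic * (fromCols Sg Sgc)ᴴ = 1)
    -- block diagonalization of `A`
    (hA : A * fromCols Xi Xic =
      fromCols Xi Xic * fromBlocks (lam0 • 1 + nilpotentPart k s) 0 0 A22)
    (hA22 : lam0 ∉ spectrum ℂ A22)
    -- the generic condition
    (hW : ∀ i : Finset.Icc 1 k, IsUnit (W D Xi Sg i))
    -- `Phi` is a basis matrix of an invariant subspace of `Theta_k`, represented by `Omega`
    (Omega : Matrix (Fin r) (Fin r) ℂ) (Phi : Matrix (Fin k × Fin (s k)) (Fin r) ℂ)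
    (hPhi_rank : Phi.rank = r)
    (hPhi : blockCompanion k (s k) (topS hk D Xi Sg) * Phi = Phi * Omega)
    -- the eigenvalues of `Omega` differ from the remaining eigenvalues of `Theta_k`
    -- (both counted with algebraic multiplicity)
    (hOmega : ∀ μ ∈ Omega.charpoly.roots,
      μ ∉ (blockCompanion k (s k) (topS hk D Xi Sg)).charpoly.roots - Omega.charpoly.roots) :
    ∃ (C : ℝ → Matrix (Fin r) (Fin r) ℂ) (H : ℝ → Matrix (Fin n) (Fin r) ℂ)
      (Hb : (i : Finset.Icc 1 k) → ℝ → Matrix (Fin (i : ℕ) × Fin (s i)) (Fin r) ℂ)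
      (E : ℝ → Matrix (Fin n) (Fin r) ℂ),
      (∀ᶠ t : ℝ in 𝓝[>] 0, (A + (t : ℂ) • D) * H t = H t * C t) ∧
      MatBigO (fun t => C t - (lam0 • 1 + ((t ^ (1 / (k : ℝ)) : ℝ) : ℂ) • Omega)) (2 / (k : ℝ)) ∧
      (∀ᶠ t : ℝ in 𝓝[>] 0,
        H t = subCol Xi (top hk) (firstPos (top hk)) * topRow hk Phi
          + ∑ i : Finset.Icc 1 k, blockCol Xi i * Hb i t + E t) ∧
      MatBigO E 1 ∧
      (∀ i : Finset.Icc 1 k, (i : ℕ) < k → ∀ m : Fin (i : ℕ),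
        MatBigO (fun t => blockRow (Hb i t) m) (1 - ((i : ℝ) - (m : ℝ)) / (k : ℝ))) ∧
      (∀ m : Fin k,
        MatBigO (fun t => blockRow (Hb (top hk) t) m -
            (if (m : ℕ) = 0 then 0
              else topRow hk Phi * (((t ^ (1 / (k : ℝ)) : ℝ) : ℂ) • Omega) ^ (m : ℕ)))
          (((m : ℝ) + 1) / (k : ℝ))) :=
  corollary3p5_general hk s A D lam0 Xi Sg Xic Sgc A22 hinv_right hA hA22 Omega
    (isUnit_of_invariant (isUnit_blockCompanion hk (isUnit_topS hk (hW (top hk))))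
      (by simpa using hPhi_rank) hPhi) Phi hPhi_rank hPhi hOmega
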